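/- Let $n\ge 1$ and let $H = H_1 * \dots * H_n$ be a free product of groups $H_i = G_i\times C_i$, where each $G_i$ is a nontrivial finite cyclic group, each $C_i$ is an infinite cyclic group, and the orders $|G_1|,\dots,|G_n|$ are pairwise coprime. Choose generators $a_i$ of $G_i$ and $c_i$ of $C_i$, let $F_i$ be the free group on two letters $x_i,y_i$, and let $F_i\twoheadrightarrow H_i$ be the natural minimal free presentation $x_i\mapsto (a_i,1)$, $y_i\mapsto(1,c_i)$. Let $F = F_1 * \dots * F_n\twoheadrightarrow H$ be the induced epimorphism, let $R$ be its kernel, and let $\overline{R} = R/[R,R]$ be the relation module, that is, the abelian group $R/[R,R]$ viewed as a $\mathbb{Z}H$-module through conjugation in $F$. Then the minimal number $d_H(\overline{R})$ of generators of $\overline{R}$ as a $\mathbb{Z}H$-module is $$d_H(\overline{R}) = n+1.$$ -/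

import Mathlib

namespace RelationModule

section Relation

variable {F H : Type*} [Group F] [Group H]

/-- For a normal subgroup `N` of `F`, the conjugation action of `F` on the abelian group
`N / [N, N]` (written additively): `f` sends the class of `r` to the class of `f * r * f⁻¹`. -/
def conjRep (N : Subgroup F) [N.Normal] :
    Representation ℤ F (Additive (Abelianization N)) where
  toFun f := (MonoidHom.toAdditive
    (Abelianization.map (MulAut.conjNormal f : MulAut N).toMonoidHom)).toIntLinearMap
  map_one' := by
    ext x
    obtain ⟨r, rfl⟩ := QuotientGroup.mk_surjective x.toMul
    change Additive.ofMul (Abelianization.of (MulAut.conjNormal (1 : F) r)) = _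
    rw [map_one]
    rfl
  map_mul' f g := by
    ext x
    obtain ⟨r, rfl⟩ := QuotientGroup.mk_surjective x.toMul
    change Additive.ofMul (Abelianization.of (MulAut.conjNormal (f * g) r)) = _
    rw [map_mul]
    rfl

theorem conjRep_of (N : Subgroup F) [N.Normal] (f : F) (r : N) :
    conjRep N f (Additive.ofMul (Abelianization.of r)) =
      Additive.ofMul (Abelianization.of (MulAut.conjNormal f r)) :=
  rfl

theorem conjRep_eq_one (N : Subgroup F) [N.Normal] {s : F} (hs : s ∈ N) : conjRep N s = 1 := by
  refine LinearMap.ext fun x => ?_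
  obtain ⟨r, hr⟩ := QuotientGroup.mk_surjective x.toMul
  have hx : x = Additive.ofMul (Abelianization.of r) := by
    rw [← ofMul_toMul x, ← hr]
    rfl
  have hc : (MulAut.conjNormal s r : N) = ⟨s, hs⟩ * r * ⟨s, hs⟩⁻¹ := by
    ext
    simp
  have he : Abelianization.of (MulAut.conjNormal s r : N) = Abelianization.of r := by
    rw [hc, map_mul, map_mul, map_inv, mul_right_comm, mul_inv_cancel, one_mul]
  rw [hx, conjRep_of, he]
  rfl

theorem conjRep_eq_of_map_eq (π : F →* H) {f g : F} (h : π f = π g) :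
    conjRep π.ker f = conjRep π.ker g := by
  have hk : g⁻¹ * f ∈ π.ker := by
    rw [MonoidHom.mem_ker, map_mul, map_inv, h, inv_mul_cancel]
  rw [← mul_inv_cancel_left g f, map_mul, conjRep_eq_one _ hk, mul_one]

/-- For a presentation `π : F ↠ H` with kernel `R`, the action of `H` on `R / [R, R]`
induced by conjugation in `F`: `h` acts as any `f` with `π f = h`, so `π f` sends the class of `r`
to the class of `f * r * f⁻¹`. -/
noncomputable def relationRep (π : F →* H) (hπ : Function.Surjective π) :
    Representation ℤ H (Additive (Abelianization π.ker)) where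
  toFun h := conjRep π.ker (Function.surjInv hπ h)
  map_one' := conjRep_eq_one _ (Function.surjInv_eq hπ 1)
  map_mul' h k := by
    rw [← map_mul]
    apply conjRep_eq_of_map_eq
    rw [map_mul, Function.surjInv_eq hπ, Function.surjInv_eq hπ, Function.surjInv_eq hπ]

theorem relationRep_of (π : F →* H) (hπ : Function.Surjective π) (f : F) (r : π.ker) :
    relationRep π hπ (π f) (Additive.ofMul (Abelianization.of r)) =
      Additive.ofMul (Abelianization.of (MulAut.conjNormal f r)) := by
  rw [← conjRep_of, ← conjRep_eq_of_map_eq π (Function.surjInv_eq hπ (π f))]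
  rfl

/-- The relation module `R / [R, R]` of `π : F ↠ H`, `R = ker π`; it carries Mathlib's structure
of a module over `MonoidAlgebra ℤ H` attached to a representation of `H`. -/
noncomputable abbrev RelMod (π : F →* H) (hπ : Function.Surjective π) :=
  (relationRep π hπ).asModule

end Relation

/-- The natural presentation of `G × C` attached to generators `a` of `G` and `c` of `C`:
the free group on two letters, with the first letter sent to `a` and the second to `c`. -/
def naturalPres {G C : Type*} [Group G] [Group C] (a : G) (c : C) :
    FreeGroup (Fin 2) →* G × C :=
  FreeGroup.lift ![(a, 1), (1, c)]

theorem naturalPres_surjective {G C : Type*} [Group G] [Group C] {a : G} {c : C}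
    (ha : Subgroup.zpowers a = ⊤) (hc : Subgroup.zpowers c = ⊤) :
    Function.Surjective (naturalPres a c) := by
  rintro ⟨g, h⟩
  obtain ⟨k, rfl⟩ := Subgroup.mem_zpowers_iff.1 (ha ▸ Subgroup.mem_top g)
  obtain ⟨l, rfl⟩ := Subgroup.mem_zpowers_iff.1 (hc ▸ Subgroup.mem_top h)
  exact ⟨FreeGroup.of 0 ^ k * FreeGroup.of 1 ^ l, by simp [naturalPres]⟩

/-- The homomorphism `*ᵢ Fᵢ → *ᵢ Hᵢ` of free products induced by homomorphisms `Fᵢ → Hᵢ`. -/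
def freeProdMap {ι : Type*} {F H : ι → Type*} [∀ i, Group (F i)] [∀ i, Group (H i)]
    (φ : ∀ i, F i →* H i) : Monoid.CoprodI F →* Monoid.CoprodI H :=
  Monoid.CoprodI.lift fun i => Monoid.CoprodI.of.comp (φ i)

theorem freeProdMap_surjective {ι : Type*} {F H : ι → Type*} [∀ i, Group (F i)]
    [∀ i, Group (H i)] {φ : ∀ i, F i →* H i} (hφ : ∀ i, Function.Surjective (φ i)) :
    Function.Surjective (freeProdMap φ) := by
  intro x
  induction x using Monoid.CoprodI.induction_on with
  | one => exact ⟨1, map_one _⟩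
  | of i m =>
    obtain ⟨f, rfl⟩ := hφ i m
    exact ⟨Monoid.CoprodI.of f, by simp [freeProdMap]⟩
  | mul x y hx hy =>
    obtain ⟨f, rfl⟩ := hx
    obtain ⟨g, rfl⟩ := hy
    exact ⟨f * g, map_mul _ _ _⟩

end RelationModule

/-! Write `m i` for the order of `G i`. The kernel is normally generated by `xᵢ ^ mᵢ` and `⁅xᵢ,
yᵢ⁆`, so their classes `αᵢ`, `βᵢ` generate the relation module: `2n` generators.

Upper bound: modulo the `n` elements `αᵢ + (Xᵢ - 1) βᵢ`, the identities `Xᵢ αᵢ = αᵢ` and `(1 + Xᵢ +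
⋯ + Xᵢ ^ (mᵢ - 1)) βᵢ = αᵢ - Yᵢ αᵢ` force `mᵢ² βᵢ = 0` (`sq_nsmul_eq_zero`). As the `mᵢ²` are
pairwise coprime, the single further element `∑ βᵢ` kills every `βᵢ`, hence every `αᵢ`.

Lower bound: for a prime `p` dividing some `m i₀`, there is a conjugation-invariant surjection of
the kernel onto `𝔽ₚ ^ (n + 1)`. Its coordinates are the `n` exponent sums of `xᵢ` divided by `mᵢ`,
and the corner entry of a Heisenberg representation over `𝔽ₚ`, which detects `⁅xᵢ₀, yᵢ₀⁆`. -/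

namespace RelationModule

/-! ### Generators of the relation module and its trivial quotients -/

section Classes

variable {F H : Type*} [Group F] [Group H] (π : F →* H) (hπ : Function.Surjective π)

/-- The class in the relation module of an element of the kernel of a presentation. -/
noncomputable def relClass (r : π.ker) : RelMod π hπ :=
  (relationRep π hπ).asModuleEquiv.symm (Additive.ofMul (Abelianization.of r))

theorem relClass_surjective : Function.Surjective (relClass π hπ) := fun x =>
  QuotientGroup.mk_surjective (Additive.toMul ((relationRep π hπ).asModuleEquiv x))

theorem relClass_one : relClass π hπ 1 = 0 := rfl

theorem relClass_mul (r s : π.ker) :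
    relClass π hπ (r * s) = relClass π hπ r + relClass π hπ s := rfl

theorem relClass_inv (r : π.ker) : relClass π hπ r⁻¹ = -relClass π hπ r := rfl

theorem relClass_conj (f : F) (r : π.ker) :
    relClass π hπ (MulAut.conjNormal f r) = MonoidAlgebra.of ℤ H (π f) • relClass π hπ r := by
  rw [relClass, relClass, ← relationRep_of π hπ, Representation.asModuleEquiv_symm_map_rho]

/-- If the kernel is the normal closure of a set, then the relation module is generated by the
classes of the elements of that set. -/
theorem eq_top_of_relClass_mem {T : Set F} (hT : π.ker = Subgroup.normalClosure T)
    (S : Submodule (MonoidAlgebra ℤ H) (RelMod π hπ))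
    (hS : ∀ r : π.ker, (r : F) ∈ T → relClass π hπ r ∈ S) : S = ⊤ := by
  -- Kernel elements with class in `S` form a subgroup of `F`, normal because `S` is stable under
  -- `H`.
  let N : Subgroup F :=
    { carrier := {f | ∃ hf : f ∈ π.ker, relClass π hπ ⟨f, hf⟩ ∈ S}
      one_mem' := ⟨one_mem _, S.zero_mem⟩
      mul_mem' := fun {f g} ⟨hf, hf'⟩ ⟨hg, hg'⟩ => ⟨mul_mem hf hg, S.add_mem hf' hg'⟩
      inv_mem' := fun {f} ⟨hf, hf'⟩ => ⟨inv_mem hf, S.neg_mem hf'⟩ }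
  have hN : N.Normal := ⟨fun f ⟨hf, hf'⟩ g => ⟨Subgroup.Normal.conj_mem inferInstance f hf g, by
    have := relClass_conj π hπ g ⟨f, hf⟩
    rw [show (⟨g * f * g⁻¹, _⟩ : π.ker) = MulAut.conjNormal g ⟨f, hf⟩ from
      Subtype.ext (MulAut.conjNormal_apply g ⟨f, hf⟩).symm, this]
    exact S.smul_mem _ hf'⟩⟩
  have hle : π.ker ≤ N := by
    conv_lhs => rw [hT]
    refine Subgroup.normalClosure_le_normal fun t ht => ?_
    have hk : t ∈ π.ker := hT ▸ Subgroup.subset_normalClosure ht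
    exact ⟨hk, hS ⟨t, hk⟩ ht⟩
  refine top_unique fun x _ => ?_
  obtain ⟨r, rfl⟩ := relClass_surjective π hπ x
  exact (hle r.2).2

/-- A homomorphism from the kernel to a vector space over a prime field that is invariant under
conjugation and hits a basis bounds the number of generators of the relation module from below. -/
theorem card_le_spanRank {p : ℕ} [Fact p.Prime] {κ : Type} [Fintype κ] [DecidableEq κ]
    (φ : π.ker →* Multiplicative (κ → ZMod p))
    (hconj : ∀ (f : F) (r : π.ker), φ (MulAut.conjNormal f r) = φ r)
    (hbasis : ∀ k, ∃ r, φ r = Multiplicative.ofAdd (Pi.single k 1)) :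
    (Fintype.card κ : Cardinal) ≤
      (⊤ : Submodule (MonoidAlgebra ℤ H) (RelMod π hπ)).spanRank := by
  let Φ : RelMod π hπ →+ (κ → ZMod p) :=
    (MonoidHom.toAdditiveLeft (Abelianization.lift φ)).comp
      (relationRep π hπ).asModuleEquiv.toAddEquiv.toAddMonoidHom
  have hΦ : ∀ r, Φ (relClass π hπ r) = (φ r).toAdd := fun r => rfl
  obtain ⟨s, hcard, hspan⟩ := Submodule.exists_span_set_card_eq_spanRank
    (⊤ : Submodule (MonoidAlgebra ℤ H) (RelMod π hπ))
  rw [← hcard]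
  -- Invariance of `φ` makes each group element act trivially after `Φ`, so `ℤH`-combinations become
  -- integer combinations.
  have hmem : ∀ x, Φ x ∈ Submodule.span (ZMod p) (Φ '' s) := by
    intro x
    have hx : x ∈ Submodule.span (MonoidAlgebra ℤ H) s := hspan ▸ Submodule.mem_top
    induction hx using Submodule.span_induction with
    | mem x hx => exact Submodule.subset_span ⟨x, hx, rfl⟩
    | zero => simp
    | add x y _ _ hx hy => rw [map_add]; exact add_mem hx hy
    | smul a x _ hx =>
      induction a using MonoidAlgebra.induction_on with
      | of h =>
        obtain ⟨f, rfl⟩ := hπ h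
        obtain ⟨r, rfl⟩ := relClass_surjective π hπ x
        rwa [← relClass_conj, hΦ, hconj, ← hΦ]
      | add a b ha hb => rw [add_smul, map_add]; exact add_mem ha hb
      | smul z a ha =>
        rw [smul_assoc, map_zsmul]
        exact zsmul_mem ha z
  have htop : Submodule.span (ZMod p) (Φ '' s) = ⊤ := by
    rw [eq_top_iff, ← (Pi.basisFun (ZMod p) κ).span_eq, Submodule.span_le]
    rintro _ ⟨k, rfl⟩
    obtain ⟨r, hr⟩ := hbasis k
    have := hmem (relClass π hπ r)
    rw [hΦ, hr] at this
    rwa [Pi.basisFun_apply]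
  have h1 : Module.rank (ZMod p) (κ → ZMod p) ≤ Cardinal.mk (Φ '' s) := by
    rw [← rank_top, ← htop]
    exact rank_span_le _
  rw [rank_fun'] at h1
  have h2 := Cardinal.lift_le.2 h1
  have h3 := h2.trans (Cardinal.mk_image_le_lift (f := Φ) (s := s))
  simpa using h3

end Classes

/-! ### Torsion and coprimality in the quotient module -/

section Algebra

variable {A M : Type*} [Ring A] [AddCommGroup M] [Module A M]

theorem sum_pow_smul_of_smul_eq {X : A} {v : M} (h : X • v = v) (m : ℕ) :
    (∑ k ∈ Finset.range m, X ^ k) • v = m • v := by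
  have hk : ∀ k : ℕ, X ^ k • v = v := fun k => by
    induction k with
    | zero => rw [pow_zero, one_smul]
    | succ k ih => rw [pow_succ, mul_smul, h, ih]
  rw [Finset.sum_smul, Finset.sum_congr rfl fun k _ => hk k, Finset.sum_const, Finset.card_range]

/-- Killing `α + (X - 1) β` makes the other generator `β` torsion. -/
theorem sq_nsmul_eq_zero {X Y : A} (hXY : Commute X Y) {m : ℕ} {α β : M} (hα : X • α = α)
    (hβ : (∑ k ∈ Finset.range m, X ^ k) • β = α - Y • α) (hγ : α + (X - 1) • β = 0) :
    (m ^ 2) • β = 0 := by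
  have hα' : (X - 1) • β = -α := eq_neg_of_add_eq_zero_right hγ
  have hcomm : (X - 1) * (∑ k ∈ Finset.range m, X ^ k) =
      (∑ k ∈ Finset.range m, X ^ k) * (X - 1) :=
    (mul_geom_sum X m).trans (geom_sum_mul X m).symm
  -- Applying `X - 1` to `hβ` kills the right side, as `X` fixes `α` and `Y • α`; on the left it
  -- passes the geometric sum and turns `β` into `-α`.
  have hmα : m • α = 0 := by
    have h1 : (X - 1) • (∑ k ∈ Finset.range m, X ^ k) • β = 0 := by
      rw [hβ, sub_smul, one_smul, smul_sub, ← mul_smul, hXY.eq, mul_smul, hα, sub_self]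
    rw [← mul_smul, hcomm, mul_smul, hα', smul_neg, neg_eq_zero] at h1
    rwa [sum_pow_smul_of_smul_eq hα] at h1
  have hfix : X • (m • β) = m • β := by
    rw [← sub_eq_zero]
    have : (X - 1) • (m • β) = 0 := by rw [smul_comm, hα', smul_neg, hmα, neg_zero]
    rwa [sub_smul, one_smul] at this
  -- On the fixed element `m • β` the geometric sum acts as `m`, while by `hβ` it gives `m • (α - Y
  -- • α) = 0`.
  rw [pow_two, mul_smul, ← sum_pow_smul_of_smul_eq hfix, smul_comm, hβ, smul_sub, smul_comm m Y,
    hmα, smul_zero, sub_zero]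

/-- Elements of pairwise coprime torsion whose sum vanishes are zero. -/
theorem eq_zero_of_sum_eq_zero_of_coprime {ι : Type*} [Fintype ι] {m : ι → ℕ}
    (hcop : Pairwise fun i j => (m i).Coprime (m j)) {β : ι → M}
    (hm : ∀ i, m i • β i = 0) (hsum : ∑ i, β i = 0) (i : ι) : β i = 0 := by
  classical
  let K := ∏ j ∈ Finset.univ.erase i, m j
  have hK : ∀ j, j ≠ i → K • β j = 0 := fun j hj => by
    obtain ⟨q, hq⟩ := Finset.dvd_prod_of_mem m (Finset.mem_erase.2 ⟨hj, Finset.mem_univ j⟩)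
    change (∏ j ∈ Finset.univ.erase i, m j) • β j = 0
    rw [hq, mul_comm, mul_smul, hm, smul_zero]
  have hKi : K • β i = 0 := by
    have := congrArg (K • ·) hsum
    simp only [Finset.smul_sum, smul_zero] at this
    rwa [Finset.sum_eq_single i (fun j _ hj => hK j hj) (by simp)] at this
  have hc : Nat.Coprime (m i) K :=
    Nat.Coprime.prod_right fun j hj => hcop (Finset.ne_of_mem_erase hj).symm
  rw [← AddMonoid.addOrderOf_eq_one_iff]
  exact Nat.eq_one_of_dvd_coprimes hc (addOrderOf_dvd_of_nsmul_eq_zero (hm i))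
    (addOrderOf_dvd_of_nsmul_eq_zero hKi)

/-- The elements `αᵢ + (Xᵢ - 1) βᵢ` and `∑ᵢ βᵢ` generate every `αᵢ` and `βᵢ`. -/
theorem mem_of_add_smul_mem_of_sum_mem {ι : Type*} [Fintype ι] {m : ι → ℕ}
    (hcop : Pairwise fun i j => (m i).Coprime (m j)) {X Y : ι → A}
    (hXY : ∀ i, Commute (X i) (Y i)) {α β : ι → M} (hα : ∀ i, X i • α i = α i)
    (hβ : ∀ i, (∑ k ∈ Finset.range (m i), X i ^ k) • β i = α i - Y i • α i)
    (S : Submodule A M) (hγ : ∀ i, α i + (X i - 1) • β i ∈ S) (hδ : ∑ i, β i ∈ S) (i : ι) :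
    α i ∈ S ∧ β i ∈ S := by
  have hγ' : ∀ i, S.mkQ (α i) + (X i - 1) • S.mkQ (β i) = 0 := fun i => by
    rw [← map_smul, ← map_add]
    exact (Submodule.Quotient.mk_eq_zero S).2 (hγ i)
  have hβ0 : S.mkQ (β i) = 0 := by
    refine eq_zero_of_sum_eq_zero_of_coprime (β := fun i => S.mkQ (β i)) (m := fun i => m i ^ 2)
      (fun i j hij => (hcop hij).pow 2 2)
      (fun i => sq_nsmul_eq_zero (hXY i) (α := S.mkQ (α i)) ?_ ?_ (hγ' i)) ?_ i
    · rw [← map_smul, hα]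
    · rw [← map_smul, hβ, map_sub, map_smul]
    · rw [← map_sum]
      exact (Submodule.Quotient.mk_eq_zero S).2 hδ
  have hα0 : S.mkQ (α i) = 0 := by
    have := hγ' i
    rwa [hβ0, smul_zero, add_zero] at this
  exact ⟨(Submodule.Quotient.mk_eq_zero S).1 hα0, (Submodule.Quotient.mk_eq_zero S).1 hβ0⟩

end Algebra

end RelationModule

/-! ### Relators of the free product and the upper bound -/

namespace RelationModule

open scoped commutatorElement

section Presentation

variable {ι : Type*}

/-- The first letter of the `i`-th factor of a free product of free groups on two letters. -/
def letterX (i : ι) : Monoid.CoprodI fun _ : ι => FreeGroup (Fin 2) :=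
  Monoid.CoprodI.of (i := i) (FreeGroup.of 0)

/-- The second letter of the `i`-th factor of a free product of free groups on two letters. -/
def letterY (i : ι) : Monoid.CoprodI fun _ : ι => FreeGroup (Fin 2) :=
  Monoid.CoprodI.of (i := i) (FreeGroup.of 1)

/-- The homomorphism with prescribed values on the letters. -/
def letterLift {K : Type*} [Group K] (u v : ι → K) :
    (Monoid.CoprodI fun _ : ι => FreeGroup (Fin 2)) →* K :=
  Monoid.CoprodI.lift fun i => FreeGroup.lift ![u i, v i]

theorem letterLift_letterX {K : Type*} [Group K] (u v : ι → K) (i : ι) :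
    letterLift u v (letterX i) = u i := by
  simp [letterLift, letterX]

theorem letterLift_letterY {K : Type*} [Group K] (u v : ι → K) (i : ι) :
    letterLift u v (letterY i) = v i := by
  simp [letterLift, letterY]

theorem letter_hom_ext {K : Type*} [Group K]
    {f g : (Monoid.CoprodI fun _ : ι => FreeGroup (Fin 2)) →* K}
    (hX : ∀ i, f (letterX i) = g (letterX i)) (hY : ∀ i, f (letterY i) = g (letterY i)) :
    f = g := by
  refine Monoid.CoprodI.ext_hom _ _ fun i => FreeGroup.ext_hom _ _ fun k => ?_
  fin_cases k
  · exact hX i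
  · exact hY i

/-- The relators `xᵢ ^ mᵢ` and `⁅xᵢ, yᵢ⁆`. -/
def relators (m : ι → ℕ) : Set (Monoid.CoprodI fun _ : ι => FreeGroup (Fin 2)) :=
  (Set.range fun i => letterX i ^ m i) ∪ Set.range fun i => ⁅letterX i, letterY i⁆

variable {G C : ι → Type*} [∀ i, Group (G i)] [∀ i, Group (C i)] (a : ∀ i, G i) (c : ∀ i, C i)

/-- The presentation of the free product of the groups `Gᵢ × Cᵢ`. -/
abbrev freePres : (Monoid.CoprodI fun _ : ι => FreeGroup (Fin 2)) →*
    Monoid.CoprodI fun i => G i × C i :=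
  freeProdMap fun i => naturalPres (a i) (c i)

theorem freePres_letterX (i : ι) :
    freePres a c (letterX i) = Monoid.CoprodI.of (i := i) (a i, (1 : C i)) := by
  simp [freeProdMap, letterX, naturalPres]

theorem freePres_letterY (i : ι) :
    freePres a c (letterY i) = Monoid.CoprodI.of (i := i) ((1 : G i), c i) := by
  simp [freeProdMap, letterY, naturalPres]

theorem commute_freePres (i : ι) :
    Commute (freePres a c (letterX i)) (freePres a c (letterY i)) := by
  rw [freePres_letterX, freePres_letterY]
  refine Commute.map ?_ _
  simp [commute_iff_eq]

theorem letterX_pow_mem_ker (i : ι) : letterX i ^ Nat.card (G i) ∈ (freePres a c).ker := by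
  rw [MonoidHom.mem_ker, map_pow, freePres_letterX, ← map_pow, Prod.pow_mk, pow_card_eq_one',
    one_pow]
  exact map_one _

theorem commutator_mem_ker (i : ι) : ⁅letterX i, letterY i⁆ ∈ (freePres a c).ker := by
  rw [MonoidHom.mem_ker, map_commutatorElement, commutatorElement_eq_one_iff_commute]
  exact commute_freePres a c i

variable {a c}

/-- The relators suffice to define a map from the free product back to `F / N` through which the
quotient map factors. -/
theorem ker_freePres (ha : ∀ i, Subgroup.zpowers (a i) = ⊤)
    [∀ i, Infinite (C i)] (hc : ∀ i, Subgroup.zpowers (c i) = ⊤) :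
    (freePres a c).ker = Subgroup.normalClosure (relators fun i => Nat.card (G i)) := by
  set N := Subgroup.normalClosure (relators (ι := ι) fun i => Nat.card (G i))
  refine le_antisymm ?_ (Subgroup.normalClosure_le_normal ?_)
  · let q := QuotientGroup.mk' N
    have hx : ∀ i, q (letterX i) ^ Nat.card (G i) = 1 := fun i => by
      rw [← map_pow]
      exact (QuotientGroup.eq_one_iff _).2 (Subgroup.subset_normalClosure (Or.inl ⟨i, rfl⟩))
    have hxy : ∀ i, Commute (q (letterX i)) (q (letterY i)) := fun i => by
      rw [← commutatorElement_eq_one_iff_commute, ← map_commutatorElement]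
      exact (QuotientGroup.eq_one_iff _).2 (Subgroup.subset_normalClosure (Or.inr ⟨i, rfl⟩))
    have ha' : ∀ i x, x ∈ Subgroup.zpowers (a i) := fun i x => ha i ▸ Subgroup.mem_top x
    have hc' : ∀ i x, x ∈ Subgroup.zpowers (c i) := fun i x => hc i ▸ Subgroup.mem_top x
    have hao : ∀ i, orderOf (q (letterX i)) ∣ orderOf (a i) := fun i => by
      rw [orderOf_eq_card_of_forall_mem_zpowers (ha' i)]
      exact orderOf_dvd_of_pow_eq_one (hx i)
    -- An infinite cyclic generator has `orderOf` equal to `0`, so no relation is imposed on `yᵢ`.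
    have hco : ∀ i, orderOf (q (letterY i)) ∣ orderOf (c i) := fun i => by
      rw [Infinite.orderOf_eq_zero_of_forall_mem_zpowers (hc' i)]
      exact dvd_zero _
    have hcomm : ∀ i g h, Commute (monoidHomOfForallMemZpowers (ha' i) (hao i) g)
        (monoidHomOfForallMemZpowers (hc' i) (hco i) h) := fun i g h =>
      (hxy i).zpow_zpow _ _
    let s : (Monoid.CoprodI fun i => G i × C i) →* _ ⧸ N :=
      Monoid.CoprodI.lift fun i => MonoidHom.noncommCoprod
        (monoidHomOfForallMemZpowers (ha' i) (hao i))
        (monoidHomOfForallMemZpowers (hc' i) (hco i)) (hcomm i)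
    have hs : s.comp (freePres a c) = q := by
      refine letter_hom_ext (fun i => ?_) fun i => ?_
      · rw [MonoidHom.comp_apply, freePres_letterX, Monoid.CoprodI.lift_of,
          MonoidHom.noncommCoprod_apply, map_one, mul_one, monoidHomOfForallMemZpowers_apply_gen]
      · rw [MonoidHom.comp_apply, freePres_letterY, Monoid.CoprodI.lift_of,
          MonoidHom.noncommCoprod_apply, map_one, one_mul, monoidHomOfForallMemZpowers_apply_gen]
    intro f hf
    rw [← QuotientGroup.eq_one_iff]
    change q f = 1
    rw [← hs, MonoidHom.comp_apply, MonoidHom.mem_ker.1 hf, map_one]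
  · rintro _ (⟨i, rfl⟩ | ⟨i, rfl⟩)
    · exact letterX_pow_mem_ker a c i
    · exact commutator_mem_ker a c i

theorem spanRank_le [Fintype ι] (ha : ∀ i, Subgroup.zpowers (a i) = ⊤)
    [∀ i, Infinite (C i)] (hc : ∀ i, Subgroup.zpowers (c i) = ⊤)
    (hcop : Pairwise fun i j => (Nat.card (G i)).Coprime (Nat.card (G j)))
    (hπ : Function.Surjective (freePres a c)) :
    (⊤ : Submodule (MonoidAlgebra ℤ (Monoid.CoprodI fun i => G i × C i))
      (RelMod (freePres a c) hπ)).spanRank ≤ ((Fintype.card ι + 1 : ℕ) : Cardinal) := by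
  let α := fun i => relClass (freePres a c) hπ ⟨_, letterX_pow_mem_ker a c i⟩
  let β := fun i => relClass (freePres a c) hπ ⟨_, commutator_mem_ker a c i⟩
  let X := fun i => MonoidAlgebra.of ℤ _ (freePres a c (letterX i))
  let Y := fun i => MonoidAlgebra.of ℤ _ (freePres a c (letterY i))
  have hα : ∀ i, X i • α i = α i := fun i => by
    rw [← relClass_conj]
    congr 1
    ext
    rw [MulAut.conjNormal_apply]
    exact mul_inv_eq_of_eq_mul (Commute.self_pow _ _).eq
  -- Induction on `⁅x ^ (k + 1), y⁆ = x ⁅x ^ k, y⁆ x⁻¹ * ⁅x, y⁆`.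
  have hpow : ∀ i (k : ℕ) (h : ⁅letterX i ^ k, letterY i⁆ ∈ (freePres a c).ker),
      relClass (freePres a c) hπ ⟨_, h⟩ = (∑ j ∈ Finset.range k, X i ^ j) • β i := fun i k => by
    induction k with
    | zero =>
      intro h
      simp only [Finset.range_zero, Finset.sum_empty, zero_smul]
      rw [← relClass_one]
      congr 1
      ext
      simp
    | succ k ih =>
      intro h
      have h' : ⁅letterX i ^ k, letterY i⁆ ∈ (freePres a c).ker := by
        rw [MonoidHom.mem_ker, map_commutatorElement, map_pow,
          commutatorElement_eq_one_iff_commute]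
        exact (commute_freePres a c i).pow_left k
      rw [geom_sum_succ, add_smul, one_smul, mul_smul, ← ih h', ← relClass_conj, ← relClass_mul]
      congr 1
      ext
      simp only [Subgroup.coe_mul, MulAut.conjNormal_apply, commutatorElement_def]
      group
  -- The class of `⁅x ^ m, y⁆ = x ^ m * (y x ^ m y⁻¹)⁻¹` is computed in two ways.
  have hβ : ∀ i, (∑ k ∈ Finset.range (Nat.card (G i)), X i ^ k) • β i = α i - Y i • α i := by
    intro i
    have h : ⁅letterX i ^ Nat.card (G i), letterY i⁆ ∈ (freePres a c).ker := by
      rw [MonoidHom.mem_ker, map_commutatorElement,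
        MonoidHom.mem_ker.1 (letterX_pow_mem_ker a c i), commutatorElement_one_left]
    rw [← hpow i _ h, sub_eq_add_neg, ← relClass_conj, ← relClass_inv, ← relClass_mul]
    congr 1
    ext
    simp only [Subgroup.coe_mul, Subgroup.coe_inv, MulAut.conjNormal_apply, commutatorElement_def]
    group
  let g : Option ι → RelMod (freePres a c) hπ := fun o =>
    o.elim (∑ i, β i) fun i => α i + (X i - 1) • β i
  have hmem := mem_of_add_smul_mem_of_sum_mem hcop
    (fun i => (commute_freePres a c i).map (MonoidAlgebra.of ℤ _)) hα hβ
    (Submodule.span _ (Set.range g)) (fun i => Submodule.subset_span ⟨some i, rfl⟩)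
    (Submodule.subset_span ⟨none, rfl⟩)
  have htop : Submodule.span (MonoidAlgebra ℤ (Monoid.CoprodI fun i => G i × C i))
      (Set.range g) = ⊤ := by
    refine eq_top_of_relClass_mem _ hπ (ker_freePres ha hc) _ ?_
    rintro ⟨r, hr⟩ (⟨i, rfl⟩ | ⟨i, rfl⟩)
    · exact (hmem i).1
    · exact (hmem i).2
  rw [← htop]
  refine (Submodule.spanRank_span_le_card _).trans ?_
  have := Cardinal.mk_range_le_lift (f := g)
  simpa using this

end Presentation

end RelationModule

/-! ### The Heisenberg group -/

namespace RelationModule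

open scoped commutatorElement

/-- The Heisenberg group over a ring: upper unitriangular matrices of size three. -/
@[ext]
structure Heisenberg (K : Type*) where
  /-- The entry in the first row and second column. -/
  fst : K
  /-- The entry in the second row and third column. -/
  snd : K
  /-- The entry in the first row and third column. -/
  corner : K

namespace Heisenberg

variable {K : Type*} [CommRing K]

instance : Mul (Heisenberg K) :=
  ⟨fun u v => ⟨u.fst + v.fst, u.snd + v.snd, u.corner + v.corner + u.fst * v.snd⟩⟩

instance : One (Heisenberg K) := ⟨⟨0, 0, 0⟩⟩

instance : Inv (Heisenberg K) := ⟨fun u => ⟨-u.fst, -u.snd, u.fst * u.snd - u.corner⟩⟩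

@[simp] theorem mul_fst (u v : Heisenberg K) : (u * v).fst = u.fst + v.fst := rfl
@[simp] theorem mul_snd (u v : Heisenberg K) : (u * v).snd = u.snd + v.snd := rfl
@[simp] theorem mul_corner (u v : Heisenberg K) :
    (u * v).corner = u.corner + v.corner + u.fst * v.snd := rfl
@[simp] theorem one_fst : (1 : Heisenberg K).fst = 0 := rfl
@[simp] theorem one_snd : (1 : Heisenberg K).snd = 0 := rfl
@[simp] theorem one_corner : (1 : Heisenberg K).corner = 0 := rfl
@[simp] theorem inv_fst (u : Heisenberg K) : u⁻¹.fst = -u.fst := rfl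
@[simp] theorem inv_snd (u : Heisenberg K) : u⁻¹.snd = -u.snd := rfl
@[simp] theorem inv_corner (u : Heisenberg K) : u⁻¹.corner = u.fst * u.snd - u.corner := rfl

instance : Group (Heisenberg K) :=
  Group.ofLeftAxioms (fun u v w => by ext <;> simp <;> ring) (fun u => by ext <;> simp)
    (fun u => by ext <;> simp)

/-- The subgroup of matrices that vanish above the diagonal except in the corner. -/
def cornerSubgroup (K : Type*) [CommRing K] : Subgroup (Heisenberg K) where
  carrier := {u | u.fst = 0 ∧ u.snd = 0}
  one_mem' := ⟨rfl, rfl⟩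
  mul_mem' := fun {u v} hu hv => ⟨by simp [hu.1, hv.1], by simp [hu.2, hv.2]⟩
  inv_mem' := fun {u} hu => ⟨by simp [hu.1], by simp [hu.2]⟩

instance : (cornerSubgroup K).Normal :=
  ⟨fun u hu v => ⟨by simp [hu.1], by simp [hu.2]⟩⟩

theorem corner_conj {u : Heisenberg K} (hu : u ∈ cornerSubgroup K) (v : Heisenberg K) :
    (v * u * v⁻¹).corner = u.corner := by
  simp only [mul_corner, mul_fst, inv_snd, inv_corner, hu.1, hu.2]
  ring

theorem mk_fst_pow (x : K) (k : ℕ) : (⟨x, 0, 0⟩ : Heisenberg K) ^ k = ⟨k * x, 0, 0⟩ := by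
  induction k with
  | zero => ext <;> simp
  | succ k ih =>
    rw [pow_succ, ih]
    ext <;> simp
    ring

end Heisenberg

/-! ### Invariants of relators and the lower bound -/

section LowerBound

variable {ι : Type} [DecidableEq ι]

/-- The exponent sum of the first letter of the `i`-th factor. -/
def exponentX (i : ι) : (Monoid.CoprodI fun _ : ι => FreeGroup (Fin 2)) →* Multiplicative ℤ :=
  letterLift (fun j => Multiplicative.ofAdd (if j = i then 1 else 0)) 1

theorem exponentX_letterX_pow (i j : ι) (k : ℕ) :
    (exponentX i (letterX j ^ k)).toAdd = if j = i then (k : ℤ) else 0 := by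
  rw [map_pow, exponentX, letterLift_letterX, toAdd_pow, toAdd_ofAdd]
  simp

theorem exponentX_commutator (i : ι) (f g : Monoid.CoprodI fun _ : ι => FreeGroup (Fin 2)) :
    exponentX i ⁅f, g⁆ = 1 := by
  rw [map_commutatorElement, commutatorElement_eq_one_iff_commute]
  exact Commute.all _ _

/-- The homomorphism to the Heisenberg group that is elementary on the letters of the `i`-th factor
and trivial on the others. -/
def toHeisenberg (K : Type*) [CommRing K] (i : ι) :
    (Monoid.CoprodI fun _ : ι => FreeGroup (Fin 2)) →* Heisenberg K :=
  letterLift (fun j => ⟨if j = i then 1 else 0, 0, 0⟩) (fun j => ⟨0, if j = i then 1 else 0, 0⟩)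

variable {m : ι → ℕ}

theorem dvd_exponentX (i : ι) {f : Monoid.CoprodI fun _ : ι => FreeGroup (Fin 2)}
    (hf : f ∈ Subgroup.normalClosure (relators m)) : (m i : ℤ) ∣ (exponentX i f).toAdd := by
  have h : Subgroup.normalClosure (relators m) ≤
      (AddSubgroup.toSubgroup (AddSubgroup.zmultiples (m i : ℤ))).comap (exponentX i) := by
    refine Subgroup.normalClosure_le_normal ?_
    rintro _ (⟨j, rfl⟩ | ⟨j, rfl⟩)
    · refine Int.mem_zmultiples_iff.2 ?_
      rw [exponentX_letterX_pow]
      split_ifs with hj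
      · rw [hj]
      · exact dvd_zero _
    · refine Int.mem_zmultiples_iff.2 ?_
      rw [exponentX_commutator]
      exact dvd_zero _
  exact Int.mem_zmultiples_iff.1 (h hf)

theorem toHeisenberg_letterX_pow {K : Type*} [CommRing K] {i : ι} (hK : (m i : K) = 0) (j : ι) :
    toHeisenberg K i (letterX j ^ m j) = 1 := by
  rw [map_pow, toHeisenberg, letterLift_letterX, Heisenberg.mk_fst_pow]
  split_ifs with hj
  · rw [hj, hK]
    ext <;> simp
  · ext <;> simp

theorem toHeisenberg_commutator (K : Type*) [CommRing K] (i j : ι) :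
    toHeisenberg K i ⁅letterX j, letterY j⁆ = ⟨0, 0, if j = i then 1 else 0⟩ := by
  rw [map_commutatorElement, toHeisenberg, letterLift_letterX, letterLift_letterY,
    commutatorElement_def]
  split_ifs <;> ext <;> simp

/-- Once `m i` vanishes in `K`, every relator maps into the central corner subgroup, so the corner
entry is additive and conjugation-invariant on the normal closure. -/
theorem toHeisenberg_mem {K : Type*} [CommRing K] {i : ι} (hK : (m i : K) = 0)
    {f : Monoid.CoprodI fun _ : ι => FreeGroup (Fin 2)}
    (hf : f ∈ Subgroup.normalClosure (relators m)) :
    toHeisenberg K i f ∈ Heisenberg.cornerSubgroup K := by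
  have h : Subgroup.normalClosure (relators m) ≤
      (Heisenberg.cornerSubgroup K).comap (toHeisenberg K i) := by
    refine Subgroup.normalClosure_le_normal ?_
    rintro _ (⟨j, rfl⟩ | ⟨j, rfl⟩)
    · rw [SetLike.mem_coe, Subgroup.mem_comap, toHeisenberg_letterX_pow hK]
      exact one_mem _
    · rw [SetLike.mem_coe, Subgroup.mem_comap, toHeisenberg_commutator]
      exact ⟨rfl, rfl⟩
  exact h hf

theorem card_add_one_le_spanRank [Fintype ι] {H : Type*} [Group H]
    (π : (Monoid.CoprodI fun _ : ι => FreeGroup (Fin 2)) →* H) (hπ : Function.Surjective π)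
    (hker : π.ker = Subgroup.normalClosure (relators m)) (hm : ∀ i, m i ≠ 0)
    {i₀ : ι} (hi₀ : m i₀ ≠ 1) :
    ((Fintype.card ι + 1 : ℕ) : Cardinal) ≤
      (⊤ : Submodule (MonoidAlgebra ℤ H) (RelMod π hπ)).spanRank := by
  obtain ⟨p, hp, hdvd⟩ := Nat.exists_prime_and_dvd hi₀
  have : Fact p.Prime := ⟨hp⟩
  have hK : (m i₀ : ZMod p) = 0 := (ZMod.natCast_eq_zero_iff _ _).2 hdvd
  have hdiv : ∀ i (r : π.ker), (m i : ℤ) ∣ (exponentX i (r : _)).toAdd := fun i r =>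
    dvd_exponentX i (hker ▸ r.2)
  have hheis : ∀ r : π.ker, toHeisenberg (ZMod p) i₀ r ∈ Heisenberg.cornerSubgroup (ZMod p) :=
    fun r => toHeisenberg_mem hK (hker ▸ r.2)
  -- Dividing by `m i` before reducing mod `p` keeps each exponent coordinate onto, whether or not
  -- `p` divides `m i`.
  let φ : π.ker →* Multiplicative (Option ι → ZMod p) := MonoidHom.mk'
    (fun r => Multiplicative.ofAdd fun o => o.elim (toHeisenberg (ZMod p) i₀ r).corner fun i =>
      (((exponentX i (r : _)).toAdd / m i : ℤ) : ZMod p)) (by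
    intro r s
    refine congrArg Multiplicative.ofAdd (funext fun o => ?_)
    cases o with
    | none =>
      simp [(hheis r).1]
    | some i =>
      simp [Int.add_ediv_of_dvd_left (hdiv i r)])
  have hφ : ∀ r, φ r = Multiplicative.ofAdd fun o =>
      o.elim (toHeisenberg (ZMod p) i₀ r).corner fun i =>
        (((exponentX i (r : _)).toAdd / m i : ℤ) : ZMod p) := fun r => rfl
  have hmem : ∀ t ∈ relators m, t ∈ π.ker := fun t ht =>
    hker ▸ Subgroup.subset_normalClosure ht
  have := card_le_spanRank π hπ φ (fun f r => ?_) (fun o => ?_)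
  · rwa [Fintype.card_option] at this
  · rw [hφ, hφ]
    refine congrArg Multiplicative.ofAdd (funext fun o => ?_)
    cases o with
    | none =>
      simp only [Option.elim_none, MulAut.conjNormal_apply, map_mul, map_inv]
      exact Heisenberg.corner_conj (hheis r) _
    | some i =>
      simp only [Option.elim_some, MulAut.conjNormal_apply, map_mul, map_inv]
      rw [mul_comm (exponentX i f), mul_inv_cancel_right]
  -- The basis vectors come from the relators: `⁅xᵢ₀, yᵢ₀⁆` for `none`, and `xᵢ ^ mᵢ` for `some i`.
  · cases o with
    | none =>
      refine ⟨⟨_, hmem _ (Or.inr ⟨i₀, rfl⟩)⟩, ?_⟩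
      rw [hφ]
      refine congrArg Multiplicative.ofAdd (funext fun o => ?_)
      cases o with
      | none => simp [-map_commutatorElement, toHeisenberg_commutator]
      | some i => simp [-map_commutatorElement, exponentX_commutator]
    | some i =>
      refine ⟨⟨_, hmem _ (Or.inl ⟨i, rfl⟩)⟩, ?_⟩
      rw [hφ]
      refine congrArg Multiplicative.ofAdd (funext fun o => ?_)
      cases o with
      | none => simp [toHeisenberg_letterX_pow hK]
      | some j =>
        simp only [Option.elim_some, exponentX_letterX_pow, Pi.single_apply, Option.some_inj]
        by_cases hj : i = j
        · subst hj
          simp [Int.ediv_self (Int.natCast_ne_zero.2 (hm i))]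
        · simp [hj, Ne.symm hj]

end LowerBound

end RelationModule

/-- `Submodule.spanRank ⊤` is the least cardinality of a generating set of the module. -/
theorem theorem2p3 (n : ℕ) (hn : 0 < n) (G C : Fin n → Type*)
    [∀ i, Group (G i)] [∀ i, Finite (G i)] [∀ i, Nontrivial (G i)]
    [∀ i, Group (C i)] [∀ i, Infinite (C i)]
    (a : ∀ i, G i) (ha : ∀ i, Subgroup.zpowers (a i) = ⊤)
    (c : ∀ i, C i) (hc : ∀ i, Subgroup.zpowers (c i) = ⊤)
    (hcop : Pairwise fun i j => (Nat.card (G i)).Coprime (Nat.card (G j))) :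
    Submodule.spanRank
      (⊤ : Submodule (MonoidAlgebra ℤ (Monoid.CoprodI fun i => G i × C i))
        (RelationModule.RelMod
          (RelationModule.freeProdMap fun i => RelationModule.naturalPres (a i) (c i))
          (RelationModule.freeProdMap_surjective fun i =>
            RelationModule.naturalPres_surjective (ha i) (hc i)))) =
      ((n + 1 : ℕ) : Cardinal) := by
  have hcard : ∀ i, Nat.card (G i) ≠ 1 := fun i => (Finite.one_lt_card (α := G i)).ne'
  refine le_antisymm ?_ ?_
  · simpa using RelationModule.spanRank_le ha hc hcop
      (RelationModule.freeProdMap_surjective fun i =>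
        RelationModule.naturalPres_surjective (ha i) (hc i))
  -- Any factor could supply the prime; index `0` exists because `n` is positive.
  · simpa using RelationModule.card_add_one_le_spanRank (RelationModule.freePres a c)
      (RelationModule.freeProdMap_surjective fun i =>
        RelationModule.naturalPres_surjective (ha i) (hc i))
      (RelationModule.ker_freePres ha hc) (fun i => Nat.card_pos.ne') (hcard ⟨0, hn⟩)
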